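/- A two-prover one-round game $G=G(\pi,V)$ consists of a finite set $Q$ of questions, a finite non-empty set $A$ of answers, a probability distribution $\pi$ on $Q\times Q$, and a predicate $V(a,b\,|\,s,t)\in\{0,1\}$ for $a,b\in A$, $s,t\in Q$. Its entangled value is $$\omega^*(G)=\sup_{d}\ \sup_{|\psi\rangle,\,(A^s_a),\,(B^t_b)}\ \sum_{a,b,s,t}\pi(s,t)\,V(a,b\,|\,s,t)\,\langle\psi|A_a^s\otimes B_b^t|\psi\rangle,$$ where $d\ge 1$, $|\psi\rangle\in\mathbb C^d\otimes\mathbb C^d$ is a unit vector, and for each $s$ and each $t$ the families $(A^s_a)_{a\in A}$ and $(B^t_b)_{b\in A}$ consist of orthogonal projections on $\mathbb C^d$ that sum to the identity (the inner supremum is non-decreasing in $d$, so $\omega^*(G)$ is also its limit as $d\to\infty$). The game is called linear if $A$ can be identified with an abelian group $H$ in such a way that, for some function $W:Q\times Q\to H$, one has $V(a,b\,|\,s,t)=1$ if and only if $a-b=W(s,t)$ in $H$. The $m$-fold product $G^m$ is the game with questions $Q^m$ and answers $A^m$ in which the pairs $(s_i,t_i)$, $1\le i\le m$, are drawn independently from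 $\pi$, and the answers are accepted if and only if $V(a_i,b_i\,|\,s_i,t_i)=1$ for all $i$. Corollary. Let $G$ be a linear game with $\omega^*(G)=1-\varepsilon$. Then for every natural number $m$, $$(1-\varepsilon)^m\ \le\ \omega^*(G^m)\ \le\ \Bigl(1-\frac{\varepsilon}{4}\Bigr)^m .$$ -/

import Mathlib

open scoped Kronecker

/-- A one-round two-prover game `G(π, V)` with finite question set `Q` and finite answer set `A`:
a probability distribution `prob` on `Q × Q` and a predicate `V a b s t`, read `V(a, b | s, t)`. -/
structure Game (Q A : Type*) [Fintype Q] where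
  prob : Q → Q → ℝ
  prob_nonneg : ∀ s t, 0 ≤ prob s t
  prob_sum : ∑ s, ∑ t, prob s t = 1
  V : A → A → Q → Q → Bool

/-- A strategy for entangled provers of local dimension `d`: a unit vector
`ψ ∈ ℂ^d ⊗ ℂ^d` and, for every question of each prover, a projective measurement on `ℂ^d`
(orthogonal projections, indexed by the answers, that sum to the identity). -/
structure EntangledStrategy (Q A : Type*) [Fintype A] (d : ℕ) where
  ψ : Fin d × Fin d → ℂ
  ψ_unit : star ψ ⬝ᵥ ψ = 1
  alice : Q → A → Matrix (Fin d) (Fin d) ℂ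
  alice_proj : ∀ s a, IsStarProjection (alice s a)
  alice_sum : ∀ s, ∑ a, alice s a = 1
  bob : Q → A → Matrix (Fin d) (Fin d) ℂ
  bob_proj : ∀ t b, IsStarProjection (bob t b)
  bob_sum : ∀ t, ∑ b, bob t b = 1

namespace EntangledStrategy

/-- The probability `⟨ψ| A_a^s ⊗ B_b^t |ψ⟩` of the answers `a, b` on the questions `s, t`
(this number is real, so that nothing is lost by taking its real part). -/
noncomputable def answerProb {Q A : Type*} [Fintype A] {d : ℕ}
    (S : EntangledStrategy Q A d) (s t : Q) (a b : A) : ℝ :=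
  (star S.ψ ⬝ᵥ ((S.alice s a ⊗ₖ S.bob t b).mulVec S.ψ)).re

end EntangledStrategy

namespace Game

/-- The probability that the provers win `G` with the strategy `S`. -/
noncomputable def winProb {Q A : Type*} [Fintype Q] [Fintype A] (G : Game Q A) {d : ℕ}
    (S : EntangledStrategy Q A d) : ℝ :=
  ∑ s, ∑ t, ∑ a, ∑ b,
    G.prob s t * (if G.V a b s t = true then 1 else 0) * S.answerProb s t a b

/-- The entangled value `ω*(G)`: the supremum of the winning probabilities of all entangled
strategies, of all finite local dimensions. The maximum in dimension `d` does not
decrease with `d`, so that this is its limit as `d → ∞`. -/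
noncomputable def entangledValue {Q A : Type*} [Fintype Q] [Fintype A] (G : Game Q A) : ℝ :=
  sSup {p : ℝ | ∃ (d : ℕ) (S : EntangledStrategy Q A d), p = G.winProb S}

/-- `G` is linear: the answer set can be identified with an abelian group `H` so that the
answers `a, b` to `s, t` are accepted if and only if `a - b = W(s, t)` in `H`. -/
def IsLinear {Q : Type*} {A : Type*} [Fintype Q] (G : Game Q A) : Prop :=
  ∃ (H : Type) (_ : AddCommGroup H) (e : A ≃ H) (W : Q → Q → H),
    ∀ s t a b, G.V a b s t = true ↔ e a - e b = W s t

/-- The `m`-fold product `G^m`: the questions are drawn from the product distribution, and the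
answers are accepted if and only if they are accepted in each of the `m` coordinates. -/
def power {Q A : Type*} [Fintype Q] (G : Game Q A) (m : ℕ) :
    Game (Fin m → Q) (Fin m → A) where
  prob s t := ∏ i, G.prob (s i) (t i)
  prob_nonneg s t := Finset.prod_nonneg fun i _ => G.prob_nonneg (s i) (t i)
  prob_sum := by
    classical
    have h1 : ∀ s : Fin m → Q, ∑ t : Fin m → Q, ∏ i, G.prob (s i) (t i)
        = ∏ i, ∑ t, G.prob (s i) t := fun s =>
      (Fintype.prod_sum (fun i t => G.prob (s i) t)).symm
    simp only [h1]
    rw [← Fintype.prod_sum (fun (_ : Fin m) s => ∑ t, G.prob s t)]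
    simp [G.prob_sum]
  V a b s t := decide (∀ i, G.V (a i) (b i) (s i) (t i) = true)

end Game

/-! ### Quantum strategies on arbitrary finite index types. -/

section Strategies

open scoped ComplexOrder
open Matrix

/-! The lower bound comes from playing a near-optimal strategy independently in every coordinate
(`winProb_pow_le_entangledValue_power`).

For the upper bound, expand the indicator of `a - b = W s t` in characters of `H`. For each
character `χ` a strategy yields one unit vector per question and prover, so the `χ`-component of the
winning probability is at most the value of a semidefinite program over Gram matrices with unit
diagonal. Let `Γ` be the average of these values over `χ`; two facts about it give the result.

Multiplicativity: an optimal dual solution of each program (`exists_gram_dual`) is a positive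
semidefinite `dualBlock`. Entrywise products of such blocks over the coordinates are again dual
solutions, by the Schur product theorem, so every strategy for `G^m` wins with probability at most
`Γ ^ m` (`winProb_power_le`).

Rounding: optimal Gram matrices for all `χ` are glued into orthonormal families of vectors, one
family per question. The provers measure along them on maximally entangled states, retrying with
fresh states until an outcome appears. This yields `ω*(G) ≥ 4Γ - 3` (`sum_gramValue_le`), that is,
`Γ ≤ 1 - ε/4`. -/

theorem IsStarProjection.kronecker {m n : Type*} [Fintype m] [Fintype n] {P : Matrix m m ℂ}
    {R : Matrix n n ℂ} (hP : IsStarProjection P) (hR : IsStarProjection R) :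
    IsStarProjection (P ⊗ₖ R) where
  isIdempotentElem := by
    rw [IsIdempotentElem, ← mul_kronecker_mul, hP.isIdempotentElem, hR.isIdempotentElem]
  isSelfAdjoint := by
    have h1 : Pᴴ = P := hP.isSelfAdjoint
    have h2 : Rᴴ = R := hR.isSelfAdjoint
    rw [IsSelfAdjoint, star_eq_conjTranspose, conjTranspose_kronecker, h1, h2]

theorem IsStarProjection.dotProduct_mulVec {n : Type*} [Fintype n] {P : Matrix n n ℂ}
    (hP : IsStarProjection P) (x : n → ℂ) :
    star x ⬝ᵥ (P *ᵥ x) = star (P *ᵥ x) ⬝ᵥ (P *ᵥ x) := by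
  have h1 : Pᴴ = P := hP.isSelfAdjoint
  rw [star_mulVec, h1, ← Matrix.dotProduct_mulVec, mulVec_mulVec, hP.isIdempotentElem]

theorem IsStarProjection.dotProduct_mulVec_nonneg {n : Type*} [Fintype n] {P : Matrix n n ℂ}
    (hP : IsStarProjection P) (x : n → ℂ) : 0 ≤ star x ⬝ᵥ (P *ᵥ x) := by
  rw [hP.dotProduct_mulVec]
  exact dotProduct_star_self_nonneg _

theorem IsStarProjection.reindex {m n : Type*} [Fintype m] [Fintype n] {P : Matrix m m ℂ}
    (hP : IsStarProjection P) (e : m ≃ n) : IsStarProjection (P.submatrix e.symm e.symm) where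
  isIdempotentElem := by
    rw [IsIdempotentElem, submatrix_mul_equiv, hP.isIdempotentElem]
  isSelfAdjoint := by
    have h1 : Pᴴ = P := hP.isSelfAdjoint
    rw [IsSelfAdjoint, star_eq_conjTranspose, conjTranspose_submatrix, h1]

theorem sum_kronecker_sum {m n A B : Type*} [Fintype A] [Fintype B]
    (P : A → Matrix m m ℂ) (R : B → Matrix n n ℂ) :
    ∑ a, ∑ b, (P a ⊗ₖ R b) = (∑ a, P a) ⊗ₖ (∑ b, R b) := by
  ext i j
  simp [Matrix.sum_apply, Finset.sum_mul_sum]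

namespace EntangledStrategy

variable {Q A : Type*} [Fintype A]

/-- Lets the strategies built below live on index types such as `Fin m → Fin d` and `ν × ι`; an
enumeration of `ι` carries them to `Fin`. -/
theorem exists_of_fintype {ι : Type*} [Fintype ι] [DecidableEq ι] (ψ : ι × ι → ℂ)
    (hψ : star ψ ⬝ᵥ ψ = 1) (P R : Q → A → Matrix ι ι ℂ)
    (hP : ∀ s a, IsStarProjection (P s a)) (hP1 : ∀ s, ∑ a, P s a = 1)
    (hR : ∀ t b, IsStarProjection (R t b)) (hR1 : ∀ t, ∑ b, R t b = 1) :
    ∃ S : EntangledStrategy Q A (Fintype.card ι), ∀ s t a b,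
      S.answerProb s t a b = (star ψ ⬝ᵥ ((P s a ⊗ₖ R t b) *ᵥ ψ)).re := by
  let e := Fintype.equivFin ι
  let f : Fin (Fintype.card ι) × Fin (Fintype.card ι) ≃ ι × ι := e.symm.prodCongr e.symm
  have hsum : ∀ T : Q → A → Matrix ι ι ℂ, (∀ s, ∑ a, T s a = 1) →
      ∀ s, ∑ a, (T s a).submatrix e.symm e.symm = 1 := by
    intro T hT s
    have := congrArg (fun N : Matrix ι ι ℂ => N.submatrix e.symm e.symm) (hT s)
    rw [submatrix_one_equiv] at this
    rw [← this]
    ext i j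
    simp [Matrix.sum_apply]
  have hdot : ∀ u v : ι × ι → ℂ, star (u ∘ f) ⬝ᵥ (v ∘ f) = star u ⬝ᵥ v := fun u v =>
    f.sum_comp (fun x => star (u x) * v x)
  refine ⟨⟨ψ ∘ f, by rw [hdot, hψ], fun s a => (P s a).submatrix e.symm e.symm,
    fun s a => (hP s a).reindex e, hsum P hP1, fun s a => (R s a).submatrix e.symm e.symm,
    fun s a => (hR s a).reindex e, hsum R hR1⟩, fun s t a b => ?_⟩
  have : ((P s a).submatrix e.symm e.symm ⊗ₖ (R t b).submatrix e.symm e.symm)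
      = (P s a ⊗ₖ R t b).submatrix f f := by
    ext i j; rfl
  simp only [answerProb, this]
  rw [submatrix_mulVec_equiv, Function.comp_assoc, Equiv.self_comp_symm, Function.comp_id, hdot]

variable {d : ℕ} (S : EntangledStrategy Q A d)

theorem answerProb_eq (s t : Q) (a b : A) :
    (S.answerProb s t a b : ℂ) = star S.ψ ⬝ᵥ ((S.alice s a ⊗ₖ S.bob t b) *ᵥ S.ψ) := by
  have h := ((S.alice_proj s a).kronecker (S.bob_proj t b)).dotProduct_mulVec_nonneg S.ψ
  exact (Complex.eq_re_of_ofReal_le (r := 0) (by simpa using h)).symm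

theorem answerProb_nonneg (s t : Q) (a b : A) : 0 ≤ S.answerProb s t a b := by
  have h := ((S.alice_proj s a).kronecker (S.bob_proj t b)).dotProduct_mulVec_nonneg S.ψ
  exact (Complex.le_def.1 h).1

theorem sum_answerProb (s t : Q) : ∑ a, ∑ b, S.answerProb s t a b = 1 := by
  have h : ((∑ a, ∑ b, S.answerProb s t a b : ℝ) : ℂ) = 1 := by
    push_cast
    simp only [answerProb_eq, ← dotProduct_sum, ← sum_mulVec, sum_kronecker_sum, S.alice_sum,
      S.bob_sum, one_kronecker_one, one_mulVec, S.ψ_unit]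
  exact_mod_cast h

end EntangledStrategy

namespace Game

variable {Q A : Type*} [Fintype Q] [Fintype A] (G : Game Q A)

theorem winProb_nonneg {d : ℕ} (S : EntangledStrategy Q A d) : 0 ≤ G.winProb S := by
  unfold winProb
  refine Finset.sum_nonneg fun s _ => Finset.sum_nonneg fun t _ => Finset.sum_nonneg fun a _ =>
    Finset.sum_nonneg fun b _ => ?_
  have := G.prob_nonneg s t
  have := S.answerProb_nonneg s t a b
  positivity

theorem winProb_le_one {d : ℕ} (S : EntangledStrategy Q A d) : G.winProb S ≤ 1 := by
  unfold winProb
  refine le_trans ?_ G.prob_sum.le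
  refine Finset.sum_le_sum fun s _ => Finset.sum_le_sum fun t _ => ?_
  calc _ ≤ ∑ a, ∑ b, G.prob s t * S.answerProb s t a b := by
        refine Finset.sum_le_sum fun a _ => Finset.sum_le_sum fun b _ => ?_
        have := G.prob_nonneg s t
        have h2 := S.answerProb_nonneg s t a b
        refine mul_le_mul_of_nonneg_right ?_ h2
        split_ifs <;> simp [this]
    _ = G.prob s t := by
        simp only [← Finset.mul_sum, S.sum_answerProb, mul_one]

theorem winProb_le_entangledValue {d : ℕ} (S : EntangledStrategy Q A d) :
    G.winProb S ≤ G.entangledValue :=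
  le_csSup ⟨1, by rintro _ ⟨d, S, rfl⟩; exact G.winProb_le_one S⟩ ⟨d, S, rfl⟩

theorem le_entangledValue_of_fintype {ι : Type*} [Fintype ι] [DecidableEq ι] (ψ : ι × ι → ℂ)
    (hψ : star ψ ⬝ᵥ ψ = 1) (P R : Q → A → Matrix ι ι ℂ)
    (hP : ∀ s a, IsStarProjection (P s a)) (hP1 : ∀ s, ∑ a, P s a = 1)
    (hR : ∀ t b, IsStarProjection (R t b)) (hR1 : ∀ t, ∑ b, R t b = 1) :
    ∑ s, ∑ t, ∑ a, ∑ b, G.prob s t * (if G.V a b s t = true then 1 else 0) *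
      (star ψ ⬝ᵥ ((P s a ⊗ₖ R t b) *ᵥ ψ)).re ≤ G.entangledValue := by
  obtain ⟨S, hS⟩ := EntangledStrategy.exists_of_fintype ψ hψ P R hP hP1 hR hR1
  simpa only [winProb, hS] using G.winProb_le_entangledValue S

end Game

end Strategies

/-! ### Tensor powers of strategies and the lower bound. -/

section TensorPower

open Matrix

/-- The tensor product of the matrices `M i`. -/
def piKronecker {m : ℕ} {ι : Type*} (M : Fin m → Matrix ι ι ℂ) :
    Matrix (Fin m → ι) (Fin m → ι) ℂ :=
  Matrix.of fun x y => ∏ i, M i (x i) (y i)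

theorem isStarProjection_piKronecker {m : ℕ} {ι : Type*} [Fintype ι] {M : Fin m → Matrix ι ι ℂ}
    (hM : ∀ i, IsStarProjection (M i)) : IsStarProjection (piKronecker M) where
  isIdempotentElem := by
    classical
    ext x y
    have h : ∀ i, ∑ j, M i (x i) j * M i j (y i) = M i (x i) (y i) := fun i =>
      congrFun (congrFun (hM i).isIdempotentElem (x i)) (y i)
    simp only [piKronecker, Matrix.mul_apply, Matrix.of_apply, ← Finset.prod_mul_distrib, ← h,
      Fintype.prod_sum]
  isSelfAdjoint := by
    ext x y
    have h : ∀ i, star (M i (y i) (x i)) = M i (x i) (y i) := fun i =>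
      congrFun (congrFun (hM i).isSelfAdjoint (x i)) (y i)
    simp only [piKronecker, Matrix.star_apply, Matrix.of_apply, ← h, star_prod]

theorem sum_piKronecker {m : ℕ} {ι A : Type*} [DecidableEq ι] [Fintype A]
    (M : Fin m → A → Matrix ι ι ℂ) (hM : ∀ i, ∑ a, M i a = 1) :
    ∑ a : Fin m → A, piKronecker (fun i => M i (a i)) = 1 := by
  classical
  ext x y
  have h : ∀ i, ∑ a, M i a (x i) (y i) = (1 : Matrix ι ι ℂ) (x i) (y i) := fun i => by
    rw [← hM i, Matrix.sum_apply]
  rw [Matrix.sum_apply]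
  simp only [piKronecker, Matrix.of_apply]
  rw [← Fintype.prod_sum (fun i a => M i a (x i) (y i))]
  simp only [h, Matrix.one_apply, Finset.prod_ite_zero, Finset.prod_const_one, funext_iff,
    Finset.mem_univ, true_imp_iff]

theorem dotProduct_piKronecker {m : ℕ} {ι : Type*} [Fintype ι]
    (ψ : ι × ι → ℂ) (M N : Fin m → Matrix ι ι ℂ) :
    (star fun x : (Fin m → ι) × (Fin m → ι) => ∏ i, ψ (x.1 i, x.2 i)) ⬝ᵥ
      ((piKronecker M ⊗ₖ piKronecker N) *ᵥ fun x => ∏ i, ψ (x.1 i, x.2 i))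
      = ∏ i, star ψ ⬝ᵥ ((M i ⊗ₖ N i) *ᵥ ψ) := by
  classical
  simp only [dotProduct, mulVec, Fintype.sum_prod_type, Finset.mul_sum, Fintype.prod_sum,
    Finset.prod_mul_distrib, Pi.star_apply, star_prod, piKronecker, kroneckerMap_apply,
    Matrix.of_apply]

theorem piKronecker_one {m : ℕ} {ι : Type*} [DecidableEq ι] :
    piKronecker (fun _ : Fin m => (1 : Matrix ι ι ℂ)) = 1 := by
  ext x y
  simp only [piKronecker, Matrix.of_apply, Matrix.one_apply, Finset.prod_ite_zero,
    Finset.prod_const_one, funext_iff, Finset.mem_univ, true_imp_iff]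

namespace Game

variable {Q A : Type*} [Fintype Q] [Fintype A] (G : Game Q A)

theorem ofReal_winProb {d : ℕ} (S : EntangledStrategy Q A d) :
    (G.winProb S : ℂ) = ∑ s, ∑ t, ∑ a, ∑ b, (G.prob s t * (if G.V a b s t = true then 1 else 0)) *
      star S.ψ ⬝ᵥ ((S.alice s a ⊗ₖ S.bob t b) *ᵥ S.ψ) := by
  simp only [winProb, ← S.answerProb_eq]
  push_cast
  simp only [apply_ite ((↑) : ℝ → ℂ), Complex.ofReal_one, Complex.ofReal_zero]

theorem winProb_pow_le_entangledValue_power {d : ℕ} (S : EntangledStrategy Q A d) (m : ℕ) :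
    G.winProb S ^ m ≤ (G.power m).entangledValue := by
  classical
  have key := (G.power m).le_entangledValue_of_fintype
    (fun x : (Fin m → Fin d) × (Fin m → Fin d) => ∏ i, S.ψ (x.1 i, x.2 i))
    (by
      have h := dotProduct_piKronecker (m := m) S.ψ (fun _ => 1) (fun _ => 1)
      simpa only [piKronecker_one, one_kronecker_one, one_mulVec, S.ψ_unit,
        Finset.prod_const_one] using h)
    (fun s a => piKronecker fun i => S.alice (s i) (a i))
    (fun s a => piKronecker fun i => S.bob (s i) (a i))
    (fun s a => isStarProjection_piKronecker fun i => S.alice_proj _ _)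
    (fun s => sum_piKronecker (fun i => S.alice (s i)) fun i => S.alice_sum _)
    (fun s a => isStarProjection_piKronecker fun i => S.bob_proj _ _)
    (fun s => sum_piKronecker (fun i => S.bob (s i)) fun i => S.bob_sum _)
  refine le_trans (le_of_eq ?_) key
  -- As a product over coordinates the power expands, by distributivity, into a sum over question
  -- and answer tuples.
  have hpow : G.winProb S ^ m = ∏ _i : Fin m, G.winProb S := by simp
  rw [hpow]
  simp only [dotProduct_piKronecker, winProb, Fintype.prod_sum, ← S.answerProb_eq,
    ← Complex.ofReal_prod, Complex.ofReal_re, Finset.prod_mul_distrib, power, decide_eq_true_eq,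
    Finset.prod_ite_zero, Finset.prod_const_one, Finset.mem_univ, true_imp_iff]

end Game

end TensorPower

/-! ### Strong duality for the semidefinite program of one character. -/

section Duality

open scoped ComplexOrder
open Matrix

/-- The principal 2×2 minors are nonnegative, so `|G i j|² ≤ G i i * G j j`. -/
theorem Matrix.PosSemidef.norm_apply_le_one {n : Type*} [Fintype n] {G : Matrix n n ℂ}
    (hG : G.PosSemidef) (h1 : ∀ i, (G i i).re ≤ 1) (i j : n) : ‖G i j‖ ≤ 1 := by
  have hd := (hG.submatrix ![i, j]).det_nonneg
  have hre : ∀ i, 0 ≤ (G i i).re ∧ (G i i).im = 0 := fun i => by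
    have := Complex.le_def.1 (hG.diag_nonneg (i := i))
    exact ⟨this.1, this.2.symm⟩
  have hij : G j i = star (G i j) := (hG.isHermitian.apply j i).symm
  rw [det_fin_two] at hd
  have h2 := (Complex.le_def.1 hd).1
  simp [hij, (hre i).2, (hre j).2] at h2
  have h3 : ‖G i j‖ ^ 2 ≤ (G i i).re * (G j j).re := by
    rw [Complex.sq_norm, Complex.normSq_apply]; linarith
  have h4 : (G i i).re * (G j j).re ≤ 1 := mul_le_one₀ (h1 i) (hre j).1 (h1 j)
  exact (sq_le_one_iff₀ (norm_nonneg _)).1 (h3.trans h4)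

/-- Bounding the diagonal instead of fixing it leaves room to perturb a maximizer; a deficient
diagonal is filled up afterwards. -/
theorem isCompact_posSemidef_diag_le_one (n : Type*) [Fintype n] :
    IsCompact {G : Matrix n n ℂ | G.PosSemidef ∧ ∀ i, (G i i).re ≤ 1} := by
  have hK : IsCompact (Set.univ.pi fun _ : n => Set.univ.pi fun _ : n =>
      Metric.closedBall (0 : ℂ) 1) :=
    isCompact_univ_pi fun _ => isCompact_univ_pi fun _ => isCompact_closedBall 0 1
  refine IsCompact.of_isClosed_subset hK ?_ ?_
  · have : {G : Matrix n n ℂ | G.PosSemidef ∧ ∀ i, (G i i).re ≤ 1}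
        = ({G : Matrix n n ℂ | Gᴴ = G} ∩ ⋂ x : n → ℂ, {G | 0 ≤ star x ⬝ᵥ (G *ᵥ x)}) ∩
          ⋂ i, {G | (G i i).re ≤ 1} := by
      ext G
      simp [posSemidef_iff_dotProduct_mulVec, Matrix.IsHermitian]
    rw [this]
    refine ((isClosed_eq (by fun_prop) (by fun_prop)).inter
      (isClosed_iInter fun x => isClosed_le continuous_const ?_)).inter
      (isClosed_iInter fun i => isClosed_le ?_ continuous_const)
    · fun_prop
    · exact Complex.continuous_re.comp (continuous_id.matrix_elem i i)
  · rintro G ⟨hG, h1⟩ i - j -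
    simpa using hG.norm_apply_le_one h1 i j

theorem nonpos_of_forall_le_mul {L K : ℝ} (h : ∀ t : ℝ, 0 < t → L ≤ t * K) : L ≤ 0 := by
  refine le_of_forall_pos_le_add fun δ hδ => ?_
  have hK : 0 < |K| + 1 := by positivity
  refine (h (δ / (|K| + 1)) (by positivity)).trans ?_
  rw [div_mul_eq_mul_div, div_le_iff₀ hK]
  nlinarith [le_abs_self K]

/-- The matrix with the diagonal blocks `diagonal α`, `diagonal β` and the off-diagonal
blocks `M`, `Mᴴ`. -/
noncomputable def dualBlock {Q : Type*} [DecidableEq Q] (M : Q → Q → ℂ) (α β : Q → ℝ) :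
    Matrix (Q ⊕ Q) (Q ⊕ Q) ℂ :=
  fromBlocks (diagonal fun s => (α s : ℂ)) (Matrix.of M) (Matrix.of M)ᴴ
    (diagonal fun t => (β t : ℂ))

theorem isHermitian_dualBlock {Q : Type*} [DecidableEq Q] (M : Q → Q → ℂ) (α β : Q → ℝ) :
    (dualBlock M α β).IsHermitian := by
  unfold dualBlock Matrix.IsHermitian
  rw [fromBlocks_conjTranspose, diagonal_conjTranspose, diagonal_conjTranspose,
    conjTranspose_conjTranspose]
  congr 2 <;> (ext s; simp)

variable {Q : Type*} [Fintype Q]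

/-- The value at the Gram matrix `G` of the bilinear form with coefficients `M`. -/
noncomputable def gramValue (M : Q → Q → ℂ) (G : Matrix (Q ⊕ Q) (Q ⊕ Q) ℂ) : ℝ :=
  (∑ s, ∑ t, M s t * G (Sum.inl s) (Sum.inr t)).re

/-- First-order optimality of `G`: mixing in a small multiple of the rank-one matrix `z z*`, while
keeping the diagonal feasible, cannot increase the value. Read as a quadratic inequality in `z`,
this is dual feasibility, so no separation theorem is needed. -/
theorem gramValue_perturb (M : Q → Q → ℂ) (G : Matrix (Q ⊕ Q) (Q ⊕ Q) ℂ)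
    (hG : G.PosSemidef) (h1 : ∀ i, (G i i).re ≤ 1)
    (hmax : ∀ G' : Matrix (Q ⊕ Q) (Q ⊕ Q) ℂ, G'.PosSemidef → (∀ i, (G' i i).re ≤ 1) →
      gramValue M G' ≤ gramValue M G) (z : Q ⊕ Q → ℂ) :
    (∑ s, ∑ t, M s t * (z (Sum.inl s) * star (z (Sum.inr t))
      - ((‖z (Sum.inl s)‖ ^ 2 / 2 + ‖z (Sum.inr t)‖ ^ 2 / 2 : ℝ) : ℂ)
        * G (Sum.inl s) (Sum.inr t))).re ≤ 0 := by
  classical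
  -- With this choice, shrinking row and column `i` by `1 - t * a i` offsets the diagonal increase
  -- `t * ‖z i‖ ^ 2` to first order in `t`; the excess is at most `C * t ^ 2`.
  set a : Q ⊕ Q → ℝ := fun i => ‖z i‖ ^ 2 / 2 with ha
  have ha0 : ∀ i, 0 ≤ a i := fun i => by positivity
  set C : ℝ := ∑ i, a i ^ 2 with hC
  have hCi : ∀ i, a i ^ 2 ≤ C := fun i =>
    Finset.single_le_sum (f := fun i => a i ^ 2) (fun _ _ => sq_nonneg _) (Finset.mem_univ i)
  have hC0 : 0 ≤ C := Finset.sum_nonneg fun _ _ => sq_nonneg _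
  set R : ℝ := (∑ s, ∑ t, M s t * ((a (Sum.inl s) * a (Sum.inr t) : ℝ) : ℂ)
    * G (Sum.inl s) (Sum.inr t)).re with hR
  refine nonpos_of_forall_le_mul (K := gramValue M G * C - R) fun t ht => ?_
  set D : Matrix (Q ⊕ Q) (Q ⊕ Q) ℂ := diagonal fun i => ((1 - t * a i : ℝ) : ℂ) with hD
  set G1 : Matrix (Q ⊕ Q) (Q ⊕ Q) ℂ := Dᴴ * G * D + (t : ℂ) • vecMulVec z (star z) with hG1
  have hG1p : G1.PosSemidef := (hG.conjTranspose_mul_mul_same D).add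
    ((posSemidef_vecMulVec_self_star z).smul (by exact_mod_cast ht.le))
  have hent : ∀ i j, G1 i j = ((1 - t * a i : ℝ) : ℂ) * G i j * ((1 - t * a j : ℝ) : ℂ)
      + t * (z i * star (z j)) := by
    intro i j
    simp only [hG1, hD, diagonal_conjTranspose, Matrix.add_apply, Matrix.smul_apply,
      mul_diagonal, diagonal_mul, vecMulVec_apply, Pi.star_apply, smul_eq_mul]
    simp
  have hpos : 0 < 1 + C * t ^ 2 := by positivity
  have hdiag : ∀ i, (G1 i i).re ≤ 1 + C * t ^ 2 := by
    intro i
    have hz : z i * star (z i) = ((2 * a i : ℝ) : ℂ) := by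
      have := Complex.mul_conj (z i)
      rw [Complex.normSq_eq_norm_sq] at this
      rw [ha]
      simp only [Complex.star_def, this]
      push_cast; ring
    rw [hent, hz]
    have : (((1 - t * a i : ℝ) : ℂ) * G i i * ((1 - t * a i : ℝ) : ℂ)
      + t * ((2 * a i : ℝ) : ℂ)).re = (1 - t * a i) ^ 2 * (G i i).re + 2 * t * a i := by
      rw [mul_comm (((1 - t * a i : ℝ) : ℂ)) (G i i), mul_assoc, ← Complex.ofReal_mul,
        ← Complex.ofReal_mul, Complex.add_re, Complex.re_mul_ofReal, Complex.ofReal_re]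
      ring
    rw [this]
    nlinarith [mul_le_mul_of_nonneg_left (h1 i) (sq_nonneg (1 - t * a i)),
      mul_le_mul_of_nonneg_left (hCi i) (sq_nonneg t)]
  -- Rescaling removes the excess on the diagonal at a cost of second order in `t`.
  have hval := hmax (((1 + C * t ^ 2)⁻¹ : ℝ) • G1)
    (hG1p.smul (inv_nonneg.2 hpos.le)) (fun i => by
      rw [Matrix.smul_apply, Complex.smul_re, smul_eq_mul, inv_mul_le_iff₀ hpos, mul_one]
      exact hdiag i)
  have hsm : gramValue M (((1 + C * t ^ 2)⁻¹ : ℝ) • G1) = (1 + C * t ^ 2)⁻¹ * gramValue M G1 := by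
    unfold gramValue
    rw [← Complex.re_ofReal_mul]
    simp only [Matrix.smul_apply, Complex.real_smul, Finset.mul_sum]
    congr 1
    refine Finset.sum_congr rfl fun s _ => Finset.sum_congr rfl fun t _ => by ring
  rw [hsm, inv_mul_le_iff₀ hpos] at hval
  set L : ℝ := (∑ s, ∑ t, M s t * (z (Sum.inl s) * star (z (Sum.inr t))
      - ((a (Sum.inl s) + a (Sum.inr t) : ℝ) : ℂ) * G (Sum.inl s) (Sum.inr t))).re with hL
  have hexp : gramValue M G1 = gramValue M G + t * L + t ^ 2 * R := by
    have h2 : (t : ℝ) ^ 2 * R = (((t ^ 2 : ℝ) : ℂ) * ∑ s, ∑ t, M s t *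
      ((a (Sum.inl s) * a (Sum.inr t) : ℝ) : ℂ) * G (Sum.inl s) (Sum.inr t)).re := by
      rw [Complex.re_ofReal_mul]
    rw [h2, hL, ← Complex.re_ofReal_mul]
    unfold gramValue
    rw [← Complex.add_re, ← Complex.add_re]
    simp only [Finset.mul_sum, ← Finset.sum_add_distrib, hent]
    congr 1
    refine Finset.sum_congr rfl fun s _ => Finset.sum_congr rfl fun t _ => ?_
    push_cast
    ring
  rw [hexp] at hval
  have : t * L ≤ t * (t * (gramValue M G * C - R)) := by nlinarith
  exact le_of_mul_le_mul_left this ht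

theorem dotProduct_dualBlock [DecidableEq Q] (M : Q → Q → ℂ) (α β : Q → ℝ) (z : Q ⊕ Q → ℂ) :
    (star z ⬝ᵥ (dualBlock M α β *ᵥ z)).re
      = ∑ s, α s * ‖z (Sum.inl s)‖ ^ 2 + ∑ t, β t * ‖z (Sum.inr t)‖ ^ 2
        + 2 * (∑ s, ∑ t, M s t * (star (z (Sum.inl s)) * z (Sum.inr t))).re := by
  have hn : ∀ (c : ℝ) (w : ℂ), ((starRingEnd ℂ) w * (c * w)).re = c * ‖w‖ ^ 2 := fun c w => by
    rw [mul_left_comm, Complex.re_ofReal_mul, mul_comm _ w, Complex.mul_conj,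
      Complex.normSq_eq_norm_sq, Complex.ofReal_re]
  have hs : ∀ s, star z (Sum.inl s) * (∑ t, M s t * z (Sum.inr t))
      = ∑ t, M s t * (star (z (Sum.inl s)) * z (Sum.inr t)) := fun s => by
    rw [Finset.mul_sum]
    exact Finset.sum_congr rfl fun t _ => by simp only [Pi.star_apply]; ring
  have ht : (∑ t, star z (Sum.inr t) * ∑ s, star (M s t) * z (Sum.inl s))
      = star (∑ s, ∑ t, M s t * (star (z (Sum.inl s)) * z (Sum.inr t))) := by
    rw [Finset.sum_comm]
    simp only [star_sum, Finset.mul_sum, star_mul', star_star]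
    refine Finset.sum_congr rfl fun t _ => Finset.sum_congr rfl fun s _ => ?_
    simp only [Pi.star_apply]; ring
  have : star z ⬝ᵥ (dualBlock M α β *ᵥ z)
      = ∑ s, star z (Sum.inl s) * (α s * z (Sum.inl s))
        + ∑ s, ∑ t, M s t * (star (z (Sum.inl s)) * z (Sum.inr t))
        + (star (∑ s, ∑ t, M s t * (star (z (Sum.inl s)) * z (Sum.inr t)))
        + ∑ t, star z (Sum.inr t) * (β t * z (Sum.inr t))) := by
    rw [← ht]
    simp only [← hs]
    simp only [dualBlock, dotProduct, Fintype.sum_sum_type, mulVec, fromBlocks_apply₁₁,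
      fromBlocks_apply₁₂, fromBlocks_apply₂₁, fromBlocks_apply₂₂, mul_add,
      Finset.sum_add_distrib, diagonal_apply, ite_mul, zero_mul, Finset.sum_ite_eq,
      Finset.mem_univ, if_true, conjTranspose_apply, Matrix.of_apply]
    ring
  rw [this]
  simp only [Complex.add_re, Complex.re_sum, Pi.star_apply, Complex.star_def, hn, Complex.conj_re]
  ring

theorem exists_gram_dual [DecidableEq Q] (M : Q → Q → ℂ) :
    ∃ (G : Matrix (Q ⊕ Q) (Q ⊕ Q) ℂ) (α β : Q → ℝ), G.PosSemidef ∧ (∀ i, G i i = 1) ∧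
      ∑ s, α s = gramValue M G ∧ ∑ t, β t = gramValue M G ∧ (dualBlock M α β).PosSemidef := by
  obtain ⟨G, ⟨hG, h1⟩, hmax⟩ := (isCompact_posSemidef_diag_le_one (Q ⊕ Q)).exists_isMaxOn
    ⟨0, PosSemidef.zero, by simp⟩ (f := gramValue M) (by
      refine Continuous.continuousOn ?_
      unfold gramValue
      refine Complex.continuous_re.comp (continuous_finsetSum _ fun s _ =>
        continuous_finsetSum _ fun t _ => continuous_const.mul ?_)
      exact continuous_id.matrix_elem _ _)
  have hper := gramValue_perturb M G hG h1 (fun G' hG' h1' => hmax ⟨hG', h1'⟩)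
  -- Adding the missing diagonal keeps `G` positive semidefinite and leaves the value alone, since
  -- `gramValue` only sees an off-diagonal block.
  let δ : Q ⊕ Q → ℝ := fun i => 1 - (G i i).re
  have hδ : ∀ i, ((δ i : ℝ) : ℂ) = 1 - G i i := fun i => by
    have h := hG.diag_nonneg (i := i)
    have : ((G i i).re : ℂ) = G i i := (Complex.eq_re_of_ofReal_le (r := 0) (by simpa using h)).symm
    simp only [δ]; push_cast; rw [this]
  have hval : gramValue M (G + diagonal fun i => (δ i : ℂ)) = gramValue M G := by
    simp [gramValue]
  refine ⟨G + diagonal fun i => (δ i : ℂ),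
    fun s => (∑ t, M s t * G (Sum.inl s) (Sum.inr t)).re,
    fun t => (∑ s, M s t * G (Sum.inl s) (Sum.inr t)).re,
    hG.add (PosSemidef.diagonal fun i => ?_), fun i => ?_, ?_, ?_, ?_⟩
  · exact Complex.zero_le_real.2 (sub_nonneg.2 (h1 i))
  · rw [Matrix.add_apply, diagonal_apply_eq, hδ]; ring
  · rw [hval, gramValue, Complex.re_sum]
  · rw [hval, gramValue, Finset.sum_comm, Complex.re_sum]
  · have hH := isHermitian_dualBlock M
      (fun s => (∑ t, M s t * G (Sum.inl s) (Sum.inr t)).re)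
      (fun t => (∑ s, M s t * G (Sum.inl s) (Sum.inr t)).re)
    refine PosSemidef.of_dotProduct_mulVec_nonneg hH fun z => ?_
    refine Complex.le_def.2 ⟨?_, (hH.im_star_dotProduct_mulVec_self z).symm⟩
    rw [dotProduct_dualBlock, Complex.zero_re]
    -- The conjugates match the form in `dotProduct_dualBlock`; the minus sign on the second half
    -- turns the upper bound into a lower bound.
    have h := hper (Sum.elim (fun s => star (z (Sum.inl s))) fun t => - star (z (Sum.inr t)))
    simp only [Sum.elim_inl, Sum.elim_inr, norm_neg, norm_star, star_neg, star_star, mul_sub,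
      Finset.sum_sub_distrib, Complex.sub_re, mul_neg, Finset.sum_neg_distrib, Complex.neg_re] at h
    have e : (∑ s, ∑ t, M s t * (((‖z (Sum.inl s)‖ ^ 2 / 2 + ‖z (Sum.inr t)‖ ^ 2 / 2 : ℝ) : ℂ)
          * G (Sum.inl s) (Sum.inr t))).re
        = (∑ s, (∑ t, M s t * G (Sum.inl s) (Sum.inr t)).re * ‖z (Sum.inl s)‖ ^ 2) / 2
          + (∑ t, (∑ s, M s t * G (Sum.inl s) (Sum.inr t)).re * ‖z (Sum.inr t)‖ ^ 2) / 2 := by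
      have hm : ∀ (x y w : ℂ) (c : ℝ), (x * ((c : ℂ) * w)).re = (x * w).re * c := by
        intro x y w c
        rw [mul_left_comm, Complex.re_ofReal_mul, mul_comm]
      simp only [Complex.re_sum, hm _ 0, Finset.sum_mul, mul_add, Finset.sum_add_distrib,
        Finset.sum_div, mul_div_assoc]
      congr 1
      rw [Finset.sum_comm]
    rw [e] at h
    linarith

end Duality

/-! ### Multiplicativity of dual solutions and the upper bound for products. -/

section ProductBound

open scoped ComplexOrder
open Matrix

theorem posSemidef_prod {n κ : Type*} [Fintype n] (P : κ → Matrix n n ℂ)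
    (hP : ∀ i, (P i).PosSemidef) (S : Finset κ) :
    (Matrix.of fun x y => ∏ i ∈ S, P i x y).PosSemidef := by
  classical
  induction S using Finset.induction_on with
  | empty =>
    convert posSemidef_vecMulVec_self_star (fun _ : n => (1 : ℂ)) using 1
    ext x y
    simp [vecMulVec_apply]
  | insert i S hi ih =>
    have h : (Matrix.of fun x y => ∏ i ∈ insert i S, P i x y)
        = P i ⊙ Matrix.of fun x y => ∏ i ∈ S, P i x y := by
      ext x y
      simp [Finset.prod_insert hi, hadamard_apply]
    rw [h]
    exact (hP i).hadamard ih

theorem posSemidef_dualBlock_prod {Q : Type*} [Fintype Q] [DecidableEq Q] {m : ℕ}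
    (M : Fin m → Q → Q → ℂ) (α β : Fin m → Q → ℝ)
    (h : ∀ i, (dualBlock (M i) (α i) (β i)).PosSemidef) :
    (dualBlock (fun s t : Fin m → Q => ∏ i, M i (s i) (t i)) (fun s => ∏ i, α i (s i))
      (fun t => ∏ i, β i (t i))).PosSemidef := by
  -- Pulling each factor back along its coordinate makes the product block an entrywise product of
  -- positive semidefinite matrices.
  let φ : Fin m → (Fin m → Q) ⊕ (Fin m → Q) → Q ⊕ Q := fun i => Sum.map (· i) (· i)
  have hd : ∀ (s t : Fin m → Q) (a : Fin m → Q → ℝ),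
      diagonal (fun s : Fin m → Q => ((∏ i, a i (s i) : ℝ) : ℂ)) s t
        = ∏ i, diagonal (fun s => (a i s : ℂ)) (s i) (t i) := by
    intro s t a
    simp only [diagonal_apply, Finset.prod_ite_zero, Finset.mem_univ, true_imp_iff,
      funext_iff, Complex.ofReal_prod]
  convert posSemidef_prod (fun i => (dualBlock (M i) (α i) (β i)).submatrix (φ i) (φ i))
    (fun i => (h i).submatrix (φ i)) Finset.univ using 1
  ext (s | s) (t | t)
  · simpa [dualBlock, φ] using hd s t α
  · simp [dualBlock, φ]
  · simp [dualBlock, φ]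
  · simpa [dualBlock, φ] using hd s t β

theorem star_dotProduct_self_eq_sum {κ : Type*} [Fintype κ] (u : κ → ℂ) :
    star u ⬝ᵥ u = ((∑ k, ‖u k‖ ^ 2 : ℝ) : ℂ) := by
  simp [dotProduct, Complex.conj_mul']

/-- Weak duality: test the dual block on the vector formed by the `k`-th coordinates of `u` and
`-v`, and sum over `k`. -/
theorem re_sum_dotProduct_le {Q κ : Type*} [Fintype Q] [DecidableEq Q] [Fintype κ]
    {M : Q → Q → ℂ} {α β : Q → ℝ} (h : (dualBlock M α β).PosSemidef) (u v : Q → κ → ℂ)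
    (hu : ∀ s, star (u s) ⬝ᵥ u s = 1) (hv : ∀ t, star (v t) ⬝ᵥ v t = 1) :
    2 * (∑ s, ∑ t, M s t * star (u s) ⬝ᵥ v t).re ≤ ∑ s, α s + ∑ t, β t := by
  have hk : ∀ k, 0 ≤ ∑ s, α s * ‖u s k‖ ^ 2 + ∑ t, β t * ‖v t k‖ ^ 2
      - 2 * (∑ s, ∑ t, M s t * (star (u s k) * v t k)).re := by
    intro k
    have h1 := (Complex.le_def.1
      (h.dotProduct_mulVec_nonneg (Sum.elim (fun s => u s k) fun t => - v t k))).1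
    rw [dotProduct_dualBlock] at h1
    simp only [Sum.elim_inl, Sum.elim_inr, norm_neg, mul_neg, Finset.sum_neg_distrib,
      Complex.neg_re, Complex.zero_re] at h1
    linarith
  have hsum := Finset.sum_nonneg fun k (_ : k ∈ Finset.univ) => hk k
  have hn : ∀ w : κ → ℂ, star w ⬝ᵥ w = 1 → ∑ k, ‖w k‖ ^ 2 = 1 := fun w hw => by
    rw [star_dotProduct_self_eq_sum] at hw
    exact_mod_cast hw
  have e1 : ∀ (a : Q → ℝ) (w : Q → κ → ℂ), (∀ s, star (w s) ⬝ᵥ w s = 1) →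
      ∑ k, ∑ s, a s * ‖w s k‖ ^ 2 = ∑ s, a s := by
    intro a w hw
    rw [Finset.sum_comm]
    exact Finset.sum_congr rfl fun s _ => by rw [← Finset.mul_sum, hn _ (hw s), mul_one]
  have e2 : ∑ k, (∑ s, ∑ t, M s t * (star (u s k) * v t k)).re
      = (∑ s, ∑ t, M s t * star (u s) ⬝ᵥ v t).re := by
    rw [← Complex.re_sum, Finset.sum_comm]
    simp only [dotProduct, Finset.mul_sum, Pi.star_apply]
    congr 1
    refine Finset.sum_congr rfl fun s _ => ?_
    rw [Finset.sum_comm]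
  simp only [Finset.sum_sub_distrib, Finset.sum_add_distrib, ← Finset.mul_sum] at hsum
  rw [e1 α u hu, e1 β v hv, e2] at hsum
  linarith

/-- For `y` in the range of `P a`, the nonnegative numbers `⟨y, P c y⟩` add up to `⟨y, y⟩`, which
the term `c = a` already exhausts. -/
theorem IsStarProjection.mul_eq_zero_of_sum_eq_one {n A : Type*} [Fintype n] [DecidableEq n]
    [Fintype A] {P : A → Matrix n n ℂ} (hP : ∀ a, IsStarProjection (P a)) (h1 : ∑ a, P a = 1)
    {a b : A} (hab : a ≠ b) : P b * P a = 0 := by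
  classical
  have hx : ∀ x : n → ℂ, P b *ᵥ (P a *ᵥ x) = 0 := by
    intro x
    set y := P a *ᵥ x with hy
    have hay : P a *ᵥ y = y := by rw [hy, mulVec_mulVec, (hP a).isIdempotentElem]
    have hs : ∑ c, star y ⬝ᵥ (P c *ᵥ y) = star y ⬝ᵥ y := by
      rw [← dotProduct_sum, ← sum_mulVec, h1, one_mulVec]
    rw [← Finset.add_sum_erase _ _ (Finset.mem_univ a), hay, add_eq_left,
      Finset.sum_eq_zero_iff_of_nonneg fun c _ => (hP c).dotProduct_mulVec_nonneg y] at hs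
    have h2 := hs b (Finset.mem_erase.2 ⟨hab.symm, Finset.mem_univ b⟩)
    rw [(hP b).dotProduct_mulVec] at h2
    exact dotProduct_star_self_eq_zero.1 h2
  ext i j
  have := congrFun (hx (Pi.single j 1)) i
  rw [mulVec_mulVec, mulVec_single_one] at this
  exact this

/-- The operator that multiplies the range of `P a` by the scalar `c a`. -/
noncomputable def phaseSum {n A : Type*} [Fintype A] (P : A → Matrix n n ℂ) (c : A → ℂ) :
    Matrix n n ℂ :=
  ∑ a, c a • P a

theorem conjTranspose_phaseSum {n A : Type*} [Fintype n] [Fintype A]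
    {P : A → Matrix n n ℂ} (hP : ∀ a, IsStarProjection (P a)) (c : A → ℂ) :
    (phaseSum P c)ᴴ = phaseSum P (star c) := by
  have h : ∀ a, (P a)ᴴ = P a := fun a => (hP a).isSelfAdjoint
  simp only [phaseSum, conjTranspose_sum, conjTranspose_smul, h, Pi.star_apply]

theorem conjTranspose_phaseSum_mul_self {n A : Type*} [Fintype n] [DecidableEq n] [Fintype A]
    {P : A → Matrix n n ℂ} (hP : ∀ a, IsStarProjection (P a)) (h1 : ∑ a, P a = 1)
    (c : A → ℂ) (hc : ∀ a, ‖c a‖ = 1) : (phaseSum P c)ᴴ * phaseSum P c = 1 := by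
  rw [conjTranspose_phaseSum hP, ← h1, phaseSum, phaseSum, Finset.sum_mul]
  refine Finset.sum_congr rfl fun a _ => ?_
  rw [Finset.mul_sum, Finset.sum_eq_single a, smul_mul_smul_comm, (hP a).isIdempotentElem.eq,
    Pi.star_apply, Complex.star_def, Complex.conj_mul', hc, Complex.ofReal_one, one_pow, one_smul]
  · intro b _ hb
    rw [smul_mul_smul_comm, IsStarProjection.mul_eq_zero_of_sum_eq_one hP h1 hb, smul_zero]
  · intro h
    exact absurd (Finset.mem_univ a) h

theorem dotProduct_mulVec_of_isometry {n : Type*} [Fintype n] [DecidableEq n] {W : Matrix n n ℂ}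
    (hW : Wᴴ * W = 1) (x : n → ℂ) : star (W *ᵥ x) ⬝ᵥ (W *ᵥ x) = star x ⬝ᵥ x := by
  rw [star_mulVec, ← Matrix.dotProduct_mulVec, mulVec_mulVec, hW, one_mulVec]

namespace EntangledStrategy

variable {Q A : Type*} [Fintype A] {d : ℕ} (S : EntangledStrategy Q A d)

/-- Alice's half of the correlations, twisted by the phases `c`. -/
noncomputable def aliceVec (c : A → ℂ) (s : Q) : Fin d × Fin d → ℂ :=
  (phaseSum (S.alice s) c ⊗ₖ (1 : Matrix (Fin d) (Fin d) ℂ)) *ᵥ S.ψ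

/-- Bob's half of the correlations, twisted by the phases `c`. -/
noncomputable def bobVec (c : A → ℂ) (t : Q) : Fin d × Fin d → ℂ :=
  ((1 : Matrix (Fin d) (Fin d) ℂ) ⊗ₖ phaseSum (S.bob t) c) *ᵥ S.ψ

theorem aliceVec_unit {c : A → ℂ} (hc : ∀ a, ‖c a‖ = 1) (s : Q) :
    star (S.aliceVec c s) ⬝ᵥ S.aliceVec c s = 1 := by
  rw [aliceVec, dotProduct_mulVec_of_isometry, S.ψ_unit]
  rw [conjTranspose_kronecker, ← mul_kronecker_mul,
    conjTranspose_phaseSum_mul_self (S.alice_proj s) (S.alice_sum s) c hc]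
  simp

theorem bobVec_unit {c : A → ℂ} (hc : ∀ a, ‖c a‖ = 1) (t : Q) :
    star (S.bobVec c t) ⬝ᵥ S.bobVec c t = 1 := by
  rw [bobVec, dotProduct_mulVec_of_isometry, S.ψ_unit]
  rw [conjTranspose_kronecker, ← mul_kronecker_mul,
    conjTranspose_phaseSum_mul_self (S.bob_proj t) (S.bob_sum t) c hc]
  simp

theorem aliceVec_dotProduct_bobVec (c c' : A → ℂ) (s t : Q) :
    star (S.aliceVec c s) ⬝ᵥ S.bobVec c' t
      = ∑ a, ∑ b, star (c a) * c' b * S.answerProb s t a b := by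
  rw [aliceVec, bobVec, star_mulVec, ← Matrix.dotProduct_mulVec, mulVec_mulVec,
    conjTranspose_kronecker, ← mul_kronecker_mul, conjTranspose_phaseSum (S.alice_proj s),
    conjTranspose_one, mul_one, one_mul, phaseSum, phaseSum, ← sum_kronecker_sum]
  simp only [sum_mulVec, dotProduct_sum, smul_kronecker, kronecker_smul, smul_mulVec,
    dotProduct_smul, ← answerProb_eq, smul_eq_mul, Pi.star_apply]
  exact Finset.sum_congr rfl fun a _ => Finset.sum_congr rfl fun b _ => by ring

end EntangledStrategy

/-- Orthogonality of characters. The summand is split into an Alice factor and a Bob factor, with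
the conjugate that the inner product puts on Alice's side. -/
theorem indicator_eq_sum_addChar {A H : Type*} [AddCommGroup H] [Fintype H] [DecidableEq H] (e : A ≃ H) (a b : A) (w : H) :
    (if e a - e b = w then (1 : ℂ) else 0)
      = (Fintype.card H : ℂ)⁻¹ * ∑ χ : AddChar H ℂ, χ (- w) * (star (χ (- e a)) * χ (- e b)) := by
  have h : ∀ χ : AddChar H ℂ, χ (- w) * (star (χ (- e a)) * χ (- e b)) = χ (e a - e b - w) := by
    intro χ
    rw [Complex.star_def, ← AddChar.map_neg_eq_conj, neg_neg, ← AddChar.map_add_eq_mul,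
      ← AddChar.map_add_eq_mul]
    congr 1; abel
  have hc : (Fintype.card H : ℂ) ≠ 0 := Nat.cast_ne_zero.2 Fintype.card_ne_zero
  simp only [h, AddChar.sum_apply_eq_ite, sub_eq_zero]
  split_ifs <;> simp [hc]

namespace Game

variable {Q A H : Type*} [Fintype Q] [Fintype A] [AddCommGroup H] [Fintype H]

/-- The coefficients of the form whose value is the `χ`-component of the winning probability
of a linear game with shifts `W`. -/
noncomputable def fourierCoeff (G : Game Q A) (W : Q → Q → H) (χ : AddChar H ℂ) (s t : Q) : ℂ :=
  G.prob s t * χ (- W s t)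

theorem winProb_power_eq (G : Game Q A) (e : A ≃ H) (W : Q → Q → H)
    (hW : ∀ s t a b, G.V a b s t = true ↔ e a - e b = W s t) {m d : ℕ}
    (S : EntangledStrategy (Fin m → Q) (Fin m → A) d) :
    ((G.power m).winProb S : ℂ) = (((Fintype.card H : ℝ)⁻¹ ^ m : ℝ) : ℂ) *
      ∑ χ : Fin m → AddChar H ℂ, ∑ s, ∑ t, (∏ i, G.fourierCoeff W (χ i) (s i) (t i)) *
        star (S.aliceVec (fun a => ∏ i, χ i (- e (a i))) s) ⬝ᵥ
          S.bobVec (fun b => ∏ i, χ i (- e (b i))) t := by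
  classical
  have hind : ∀ (s t : Fin m → Q) (a b : Fin m → A),
      (if (G.power m).V a b s t = true then (1 : ℂ) else 0)
        = (((Fintype.card H : ℝ)⁻¹ ^ m : ℝ) : ℂ) * ∑ χ : Fin m → AddChar H ℂ,
          ∏ i, χ i (- W (s i) (t i)) * (star (χ i (- e (a i))) * χ i (- e (b i))) := by
    intro s t a b
    rw [← Fintype.prod_sum (fun i (χ : AddChar H ℂ) =>
      χ (- W (s i) (t i)) * (star (χ (- e (a i))) * χ (- e (b i))))]
    have : (((Fintype.card H : ℝ)⁻¹ ^ m : ℝ) : ℂ) = ∏ _i : Fin m, (Fintype.card H : ℂ)⁻¹ := by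
      simp
    rw [this, ← Finset.prod_mul_distrib]
    simp only [← indicator_eq_sum_addChar, Finset.prod_ite_zero, Finset.prod_const_one, power,
      decide_eq_true_eq, hW, Finset.mem_univ, true_imp_iff]
  rw [ofReal_winProb]
  simp only [← S.answerProb_eq, hind, S.aliceVec_dotProduct_bobVec]
  have h1 : ∀ F : (Fin m → AddChar H ℂ) → (Fin m → Q) → (Fin m → Q) → ℂ,
      ∑ χ, ∑ s, ∑ t, F χ s t = ∑ s, ∑ t, ∑ χ, F χ s t := by
    intro F
    rw [Finset.sum_comm]
    exact Finset.sum_congr rfl fun s _ => Finset.sum_comm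
  rw [h1, Finset.mul_sum]
  refine Finset.sum_congr rfl fun s _ => ?_
  rw [Finset.mul_sum]
  refine Finset.sum_congr rfl fun t _ => ?_
  simp only [Finset.mul_sum]
  have h2 : ∀ F : (Fin m → AddChar H ℂ) → (Fin m → A) → (Fin m → A) → ℂ,
      ∑ χ, ∑ s, ∑ t, F χ s t = ∑ s, ∑ t, ∑ χ, F χ s t := by
    intro F
    rw [Finset.sum_comm]
    exact Finset.sum_congr rfl fun s _ => Finset.sum_comm
  rw [h2]
  refine Finset.sum_congr rfl fun a _ => Finset.sum_congr rfl fun b _ => ?_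
  rw [Finset.sum_mul]
  refine Finset.sum_congr rfl fun χ _ => ?_
  simp only [fourierCoeff, Finset.prod_mul_distrib, power, star_prod]
  push_cast
  ring

/-- In the Fourier expansion the term of a tuple `χ` is at most `∏ i, γ (χ i)`, by weak duality with
the product dual solution; the sum of these products is an `m`-th power. -/
theorem winProb_power_le [DecidableEq Q] (G : Game Q A) (e : A ≃ H) (W : Q → Q → H)
    (hW : ∀ s t a b, G.V a b s t = true ↔ e a - e b = W s t)
    (γ : AddChar H ℂ → ℝ) (α β : AddChar H ℂ → Q → ℝ) (hα : ∀ χ, ∑ s, α χ s = γ χ)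
    (hβ : ∀ χ, ∑ t, β χ t = γ χ)
    (hdual : ∀ χ, (dualBlock (G.fourierCoeff W χ) (α χ) (β χ)).PosSemidef) {m d : ℕ}
    (S : EntangledStrategy (Fin m → Q) (Fin m → A) d) :
    (G.power m).winProb S ≤ ((Fintype.card H : ℝ)⁻¹ * ∑ χ, γ χ) ^ m := by
  classical
  have h := congrArg Complex.re (G.winProb_power_eq e W hW S)
  rw [Complex.ofReal_re, Complex.re_ofReal_mul, Complex.re_sum] at h
  rw [h, mul_pow]
  refine mul_le_mul_of_nonneg_left ?_ (by positivity)
  have hpow : (∑ χ, γ χ) ^ m = ∑ χ : Fin m → AddChar H ℂ, ∏ i, γ (χ i) := by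
    rw [← Fintype.prod_sum (fun (_ : Fin m) χ => γ χ)]
    simp
  rw [hpow]
  refine Finset.sum_le_sum fun χ _ => ?_
  have hnorm : ∀ a : Fin m → A, ‖∏ i, χ i (- e (a i))‖ = 1 := fun a => by
    rw [norm_prod]
    exact Finset.prod_eq_one fun i _ => AddChar.norm_apply _ _
  have key := re_sum_dotProduct_le (posSemidef_dualBlock_prod _ _ _ fun i => hdual (χ i))
    (S.aliceVec fun a => ∏ i, χ i (- e (a i))) (S.bobVec fun b => ∏ i, χ i (- e (b i)))
    (fun s => S.aliceVec_unit hnorm s) (fun t => S.bobVec_unit hnorm t)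
  rw [← Fintype.prod_sum (fun i s => α (χ i) s), ← Fintype.prod_sum (fun i s => β (χ i) s)] at key
  simp only [hα, hβ] at key
  linarith

end Game

end ProductBound

/-! ### Measurements on maximally entangled states, with a fallback strategy. -/

section Rounding

open scoped ComplexOrder
open Matrix

theorem IsStarProjection.trace_mul_nonneg {n : Type*} [Fintype n] {P R : Matrix n n ℂ}
    (hP : IsStarProjection P) (hR : IsStarProjection R) : 0 ≤ (P * R).trace := by
  have h1 : Pᴴ = P := hP.isSelfAdjoint
  have h2 : Rᴴ = R := hR.isSelfAdjoint
  have h : (P * R).trace = ((R * P)ᴴ * (R * P)).trace := by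
    rw [conjTranspose_mul, h1, h2, Matrix.mul_assoc, ← Matrix.mul_assoc R R P,
      hR.isIdempotentElem.eq, ← Matrix.mul_assoc, Matrix.trace_mul_comm (P * R) P,
      ← Matrix.mul_assoc, hP.isIdempotentElem.eq]
  rw [h]
  exact (posSemidef_conjTranspose_mul_self _).trace_nonneg

theorem IsStarProjection.ofReal_re_trace_mul {n : Type*} [Fintype n] {P R : Matrix n n ℂ}
    (hP : IsStarProjection P) (hR : IsStarProjection R) :
    (((P * R).trace.re : ℝ) : ℂ) = (P * R).trace :=
  (Complex.eq_re_of_ofReal_le (r := 0) (by simpa using hP.trace_mul_nonneg hR)).symm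

theorem IsStarProjection.transpose {n : Type*} [Fintype n] {P : Matrix n n ℂ}
    (hP : IsStarProjection P) : IsStarProjection Pᵀ where
  isIdempotentElem := by
    rw [IsIdempotentElem, ← transpose_mul, hP.isIdempotentElem.eq]
  isSelfAdjoint := by
    have h1 : Pᴴ = P := hP.isSelfAdjoint
    change (Pᴴ)ᵀ = Pᵀ
    rw [h1]

theorem isStarProjection_sum {n A : Type*} [Fintype n] {P : A → Matrix n n ℂ}
    (hP : ∀ a, IsStarProjection (P a)) (horth : ∀ a b, a ≠ b → P a * P b = 0) (S : Finset A) :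
    IsStarProjection (∑ a ∈ S, P a) := by
  classical
  induction S using Finset.induction_on with
  | empty => simp
  | insert a S ha ih =>
    rw [Finset.sum_insert ha]
    refine (hP a).add ih ?_
    rw [Finset.mul_sum]
    exact Finset.sum_eq_zero fun b hb => horth a b fun h => ha (h ▸ hb)

/-- Measurements for both provers on `ℂ^ι`, meant to be applied to the maximally entangled state,
Bob's being stated through their transposes. -/
structure TracialStrategy (Q A ι : Type*) [Fintype A] [Fintype ι] [DecidableEq ι] where
  alice : Q → A → Matrix ι ι ℂ
  alice_proj : ∀ s a, IsStarProjection (alice s a)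
  alice_sum : ∀ s, ∑ a, alice s a = 1
  bob : Q → A → Matrix ι ι ℂ
  bob_proj : ∀ t b, IsStarProjection (bob t b)
  bob_sum : ∀ t, ∑ b, bob t b = 1

/-- A family, indexed by the questions, of pairwise orthogonal projections that need not sum to
the identity. -/
structure IsPartialMeasurement {Q A ν : Type*} [Fintype ν] (P : Q → A → Matrix ν ν ℂ) : Prop where
  proj : ∀ s a, IsStarProjection (P s a)
  orth : ∀ s a b, a ≠ b → P s a * P s b = 0

namespace IsPartialMeasurement

variable {Q A ν ι : Type*} [Fintype A] [Fintype ν] [DecidableEq ν] [Fintype ι] [DecidableEq ι]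

/-- Measure with `P`, and if there is no answer measure a second system with `R`. -/
def retry (P : A → Matrix ν ν ℂ) (R : A → Matrix ι ι ℂ) (a : A) : Matrix (ν × ι) (ν × ι) ℂ :=
  P a ⊗ₖ 1 + (1 - ∑ b, P b) ⊗ₖ R a

theorem mul_sum {Q A ν : Type*} [Fintype A] [Fintype ν] {P : Q → A → Matrix ν ν ℂ}
    (hP : IsPartialMeasurement P) (s : Q) (a : A) : P s a * ∑ b, P s b = P s a := by
  rw [Finset.mul_sum, Finset.sum_eq_single a fun b _ hb => hP.orth s a b hb.symm]
  · exact (hP.proj s a).isIdempotentElem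
  · exact fun h => absurd (Finset.mem_univ a) h

theorem retry_proj {P : Q → A → Matrix ν ν ℂ} (hP : IsPartialMeasurement P) {R : A → Matrix ι ι ℂ} (hR : ∀ a, IsStarProjection (R a)) (s : Q) (a : A) :
    IsStarProjection (retry (P s) R a) := by
  refine ((hP.proj s a).kronecker (IsStarProjection.one _)).add
    ((isStarProjection_sum (hP.proj s) (hP.orth s) _).one_sub.kronecker (hR a)) ?_
  rw [← mul_kronecker_mul, mul_sub, mul_one, hP.mul_sum, sub_self, zero_kronecker]

theorem retry_sum {A ν ι : Type*} [Fintype A] [DecidableEq ν] [DecidableEq ι] {R : A → Matrix ι ι ℂ} (hR : ∑ a, R a = 1)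
    (P : A → Matrix ν ν ℂ) : ∑ a, retry P R a = 1 := by
  have h1 : ∑ a, P a ⊗ₖ (1 : Matrix ι ι ℂ) = (∑ a, P a) ⊗ₖ 1 := by
    ext i j; simp [Matrix.sum_apply, Finset.sum_mul]
  have h2 : ∑ a, (1 - ∑ b, P b) ⊗ₖ R a = (1 - ∑ b, P b) ⊗ₖ (∑ a, R a) := by
    ext i j; simp [Matrix.sum_apply, Finset.mul_sum]
  simp only [retry, Finset.sum_add_distrib]
  rw [h1, h2, hR, ← add_kronecker, add_sub_cancel, one_kronecker_one]

end IsPartialMeasurement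

namespace TracialStrategy

variable {Q A ι : Type*} [Fintype A] [Fintype ι] [DecidableEq ι]

/-- The joint distribution of the answers. -/
noncomputable def joint (T : TracialStrategy Q A ι) (s t : Q) (a b : A) : ℝ :=
  (Fintype.card ι : ℝ)⁻¹ * (T.alice s a * T.bob t b).trace.re

theorem joint_nonneg (T : TracialStrategy Q A ι) (s t : Q) (a b : A) : 0 ≤ T.joint s t a b :=
  mul_nonneg (by positivity)
    (Complex.le_def.1 ((T.alice_proj s a).trace_mul_nonneg (T.bob_proj t b))).1

theorem sum_joint_le_entangledValue [Nonempty ι] [Fintype Q] (T : TracialStrategy Q A ι)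
    (G : Game Q A) :
    ∑ s, ∑ t, ∑ a, ∑ b, G.prob s t * (if G.V a b s t = true then 1 else 0) * T.joint s t a b
      ≤ G.entangledValue := by
  set r : ℝ := (Real.sqrt (Fintype.card ι))⁻¹ with hr
  have hcard : (0 : ℝ) < Fintype.card ι := by exact_mod_cast Fintype.card_pos
  have hr2 : r * r = (Fintype.card ι : ℝ)⁻¹ := by
    rw [hr, ← mul_inv, Real.mul_self_sqrt hcard.le]
  -- The maximally entangled state, for which `⟨ψ| X ⊗ Yᵀ |ψ⟩` is the normalized trace of `X * Y`.
  let ψ : ι × ι → ℂ := fun x => if x.1 = x.2 then (r : ℂ) else 0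
  have hdot : ∀ X Y : Matrix ι ι ℂ, star ψ ⬝ᵥ ((X ⊗ₖ Yᵀ) *ᵥ ψ)
      = ((r * r : ℝ) : ℂ) * (X * Y).trace := by
    intro X Y
    have hv : ∀ i j, ((X ⊗ₖ Yᵀ) *ᵥ ψ) (i, j) = r * (X * Y) i j := by
      intro i j
      simp only [ψ, mulVec, dotProduct, Fintype.sum_prod_type, kroneckerMap_apply, transpose_apply,
        mul_ite, mul_zero, Finset.sum_ite_eq, Finset.mem_univ, if_true, Matrix.mul_apply,
        Finset.mul_sum]
      exact Finset.sum_congr rfl fun k _ => by ring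
    simp only [dotProduct, Fintype.sum_prod_type, hv]
    simp only [ψ, Pi.star_apply, apply_ite star, star_zero, ite_mul, zero_mul, Finset.sum_ite_eq,
      Finset.mem_univ, if_true, Matrix.trace, Matrix.diag, Finset.mul_sum, Complex.star_def,
      Complex.conj_ofReal]
    refine Finset.sum_congr rfl fun i _ => ?_
    push_cast; ring
  have hψ : star ψ ⬝ᵥ ψ = 1 := by
    have h := hdot 1 1
    rw [transpose_one, one_kronecker_one, one_mulVec, mul_one, trace_one, hr2] at h
    rw [h]
    push_cast
    exact inv_mul_cancel₀ (by exact_mod_cast hcard.ne')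
  have key := G.le_entangledValue_of_fintype ψ hψ T.alice (fun t b => (T.bob t b)ᵀ) T.alice_proj
    T.alice_sum (fun t b => (T.bob_proj t b).transpose)
    (fun t => by rw [← transpose_sum, T.bob_sum, transpose_one])
  simpa only [hdot, Complex.re_ofReal_mul, hr2, joint] using key

variable {ν : Type*} [Fintype ν] [DecidableEq ν] {P R : Q → A → Matrix ν ν ℂ}

/-- Measure with `P` and `R`; a prover without an answer uses the strategy `T`. -/
def retry (T : TracialStrategy Q A ι) (hP : IsPartialMeasurement P)
    (hR : IsPartialMeasurement R) : TracialStrategy Q A (ν × ι) where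
  alice s := IsPartialMeasurement.retry (P s) (T.alice s)
  alice_proj s a := hP.retry_proj (T.alice_proj s) s a
  alice_sum s := IsPartialMeasurement.retry_sum (T.alice_sum s) (P s)
  bob s := IsPartialMeasurement.retry (R s) (T.bob s)
  bob_proj s a := hR.retry_proj (T.bob_proj s) s a
  bob_sum s := IsPartialMeasurement.retry_sum (T.bob_sum s) (R s)

/-- Only two cases are kept: both provers get an answer from the first measurement, or both fall
back on `T`. The mixed cases contribute nonnegative traces. -/
theorem le_joint_retry [Nonempty ι] [Nonempty ν] (T : TracialStrategy Q A ι)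
    (hP : IsPartialMeasurement P) (hR : IsPartialMeasurement R) (s t : Q) (a b : A) :
    (Fintype.card ν : ℝ)⁻¹ * (P s a * R t b).trace.re
      + (Fintype.card ν : ℝ)⁻¹ * ((1 - ∑ a, P s a) * (1 - ∑ b, R t b)).trace.re * T.joint s t a b
      ≤ (T.retry hP hR).joint s t a b := by
  have hE := (isStarProjection_sum (hP.proj s) (hP.orth s) Finset.univ).one_sub
  have hF := (isStarProjection_sum (hR.proj t) (hR.orth t) Finset.univ).one_sub
  have h1 : IsStarProjection (1 : Matrix ι ι ℂ) := IsStarProjection.one _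
  have hι : (Fintype.card ι : ℝ) ≠ 0 := Nat.cast_ne_zero.2 Fintype.card_ne_zero
  have hmul : ∀ {X Y : Matrix ν ν ℂ} {Z W : Matrix ι ι ℂ}, IsStarProjection X →
      IsStarProjection Y → IsStarProjection Z → IsStarProjection W →
      ((X ⊗ₖ Z) * (Y ⊗ₖ W)).trace.re = (X * Y).trace.re * (Z * W).trace.re := by
    intro X Y Z W hX hY hZ hW
    rw [← mul_kronecker_mul, trace_kronecker, ← hX.ofReal_re_trace_mul hY,
      Complex.re_ofReal_mul, Complex.ofReal_re]
  have hnn : ∀ {X Y : Matrix ν ν ℂ} {Z W : Matrix ι ι ℂ}, IsStarProjection X →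
      IsStarProjection Y → IsStarProjection Z → IsStarProjection W →
      0 ≤ ((X ⊗ₖ Z) * (Y ⊗ₖ W)).trace.re := by
    intro X Y Z W hX hY hZ hW
    exact (Complex.le_def.1 ((hX.kronecker hZ).trace_mul_nonneg (hY.kronecker hW))).1
  have e : ((T.retry hP hR).alice s a * (T.retry hP hR).bob t b).trace.re
      = (P s a * R t b).trace.re * Fintype.card ι
        + ((P s a ⊗ₖ 1) * ((1 - ∑ b, R t b) ⊗ₖ T.bob t b)).trace.re
        + (((1 - ∑ a, P s a) ⊗ₖ T.alice s a) * (R t b ⊗ₖ 1)).trace.re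
        + ((1 - ∑ a, P s a) * (1 - ∑ b, R t b)).trace.re
          * (T.alice s a * T.bob t b).trace.re := by
    rw [← hmul hE hF (T.alice_proj s a) (T.bob_proj t b)]
    have h2 := hmul (hP.proj s a) (hR.proj t b) h1 h1
    rw [mul_one, trace_one, Complex.natCast_re] at h2
    rw [← h2]
    simp only [retry, IsPartialMeasurement.retry, add_mul, mul_add, trace_add, Complex.add_re]
    ring
  have n1 := hnn (hP.proj s a) hF h1 (T.bob_proj t b)
  have n2 := hnn hE (hR.proj t b) (T.alice_proj s a) h1
  have e2 : (T.retry hP hR).joint s t a b = (Fintype.card ν : ℝ)⁻¹ * (Fintype.card ι : ℝ)⁻¹ *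
      ((T.retry hP hR).alice s a * (T.retry hP hR).bob t b).trace.re := by
    rw [joint, Fintype.card_prod, Nat.cast_mul, mul_inv]
  rw [e2, e]
  calc _ = (Fintype.card ν : ℝ)⁻¹ * (Fintype.card ι : ℝ)⁻¹ *
        ((P s a * R t b).trace.re * Fintype.card ι
        + ((1 - ∑ a, P s a) * (1 - ∑ b, R t b)).trace.re
          * (T.alice s a * T.bob t b).trace.re) := by
        rw [joint]; field_simp
    _ ≤ _ := by
        refine mul_le_mul_of_nonneg_left ?_ (by positivity)
        linarith

end TracialStrategy

end Rounding

/-! ### Repeated rounding and the bound on the average semidefinite value. -/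

section Iteration

open scoped ComplexOrder
open Matrix

theorem isStarProjection_vecMulVec {n : Type*} [Fintype n] {x : n → ℂ} (hx : star x ⬝ᵥ x = 1) :
    IsStarProjection (vecMulVec x (star x)) where
  isIdempotentElem := by
    rw [IsIdempotentElem, vecMulVec_mul_vecMulVec, hx, one_smul]
  isSelfAdjoint := (posSemidef_vecMulVec_self_star x).isHermitian

theorem isPartialMeasurement_vecMulVec {Q A ν : Type*} [Fintype ν] {x : Q → A → ν → ℂ}
    (h1 : ∀ s a, star (x s a) ⬝ᵥ x s a = 1) (h0 : ∀ s a b, a ≠ b → star (x s a) ⬝ᵥ x s b = 0) :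
    IsPartialMeasurement fun s a => vecMulVec (x s a) (star (x s a)) where
  proj s a := isStarProjection_vecMulVec (h1 s a)
  orth s a b hab := by rw [vecMulVec_mul_vecMulVec, h0 s a b hab, zero_smul, vecMulVec_zero]

theorem re_trace_vecMulVec_mul {n : Type*} [Fintype n] (x y : n → ℂ) :
    (vecMulVec x (star x) * vecMulVec y (star y)).trace.re = ‖star x ⬝ᵥ y‖ ^ 2 := by
  have h : x ⬝ᵥ star y = star (star x ⬝ᵥ y) := by
    rw [star_dotProduct, star_star, dotProduct_comm]
  rw [vecMulVec_mul_vecMulVec, trace_vecMulVec, dotProduct_smul, smul_eq_mul, h,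
    Complex.star_def, Complex.mul_conj', ← Complex.ofReal_pow, Complex.ofReal_re]

/-- Here `r` is the chance that a given prover gets an answer, `r * X` that both do and win, and `p`
that neither does. The number `X / (2 - X)` is the fixed point of `w = r * X + (1 - 2 * r + r * X) *
w`, and the distance to it shrinks by `1 - r` because `1 - 2 * r + r * X ≤ 1 - r`. -/
theorem retry_recursion {X r w p c : ℝ} (hX0 : 0 ≤ X) (hX1 : X ≤ 1) (hr : 0 ≤ r)
    (hc0 : 0 ≤ c) (hc1 : c ≤ 1) (hw : X / (2 - X) * (1 - c) ≤ w) (hp0 : 0 ≤ p)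
    (hp : 1 - 2 * r + r * X ≤ p) : X / (2 - X) * (1 - (1 - r) * c) ≤ r * X + p * w := by
  have h2 : 0 < 2 - X := by linarith
  set y := X / (2 - X) with hy
  have hy0 : 0 ≤ y := div_nonneg hX0 h2.le
  have hyX : X = y * (2 - X) := by rw [hy, div_mul_cancel₀ _ h2.ne']
  have hv : 0 ≤ y * (1 - c) := mul_nonneg hy0 (by linarith)
  calc y * (1 - (1 - r) * c) ≤ y * (1 - c + (2 - X) * r * c) := by
        refine mul_le_mul_of_nonneg_left ?_ hy0
        nlinarith [mul_nonneg (mul_nonneg hr hc0) (sub_nonneg.2 hX1)]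
    _ = r * (y * (2 - X)) + (1 - 2 * r + r * X) * (y * (1 - c)) := by ring
    _ = r * X + (1 - 2 * r + r * X) * (y * (1 - c)) := by rw [← hyX]
    _ ≤ r * X + p * w := by
        have := mul_le_mul_of_nonneg_right hp hv
        have := mul_le_mul_of_nonneg_left hw hp0
        linarith

universe u

theorem exists_tracialStrategy {Q A : Type*} {ν : Type u} [Fintype A] [Nonempty A] [Fintype ν]
    [DecidableEq ν] [Nonempty ν] {P R : Q → A → Matrix ν ν ℂ} (hP : IsPartialMeasurement P)
    (hR : IsPartialMeasurement R) (hP1 : ∀ s a, (P s a).trace = 1) (hR1 : ∀ t b, (R t b).trace = 1)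
    (hcard : Fintype.card A ≤ Fintype.card ν) (V : A → A → Q → Q → Bool) (X : Q → Q → ℝ)
    (hX0 : ∀ s t, 0 ≤ X s t) (hX1 : ∀ s t, X s t ≤ 1)
    (hX : ∀ s t, ∑ a, ∑ b, (if V a b s t = true then 1 else 0) * (P s a * R t b).trace.re
      = Fintype.card A * X s t) (N : ℕ) :
    ∃ (ι : Type u) (_ : Fintype ι) (_ : DecidableEq ι) (_ : Nonempty ι)
      (T : TracialStrategy Q A ι), ∀ s t,
        X s t / (2 - X s t) * (1 - (1 - Fintype.card A / Fintype.card ν) ^ N)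
          ≤ ∑ a, ∑ b, (if V a b s t = true then 1 else 0) * T.joint s t a b := by
  classical
  have hn : (0 : ℝ) < Fintype.card ν := by exact_mod_cast Fintype.card_pos
  set r : ℝ := Fintype.card A / Fintype.card ν with hr
  have hr0 : 0 ≤ r := by positivity
  have hr1 : r ≤ 1 := (div_le_one hn).2 (by exact_mod_cast hcard)
  induction N with
  | zero =>
    obtain ⟨a₀⟩ := ‹Nonempty A›
    have hproj : ∀ a, IsStarProjection (if a = a₀ then (1 : Matrix PUnit.{u + 1} PUnit.{u + 1} ℂ)
        else 0) := by
      intro a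
      split_ifs
      · exact IsStarProjection.one _
      · exact IsStarProjection.zero _
    let T : TracialStrategy Q A PUnit.{u + 1} :=
      ⟨fun _ a => if a = a₀ then 1 else 0, fun _ => hproj, fun _ => by simp,
        fun _ a => if a = a₀ then 1 else 0, fun _ => hproj, fun _ => by simp⟩
    refine ⟨PUnit.{u + 1}, inferInstance, inferInstance, inferInstance, T, fun s t => ?_⟩
    rw [pow_zero, sub_self, mul_zero]
    exact Finset.sum_nonneg fun a _ => Finset.sum_nonneg fun b _ =>
      mul_nonneg (by positivity) (T.joint_nonneg s t a b)
  | succ N ih =>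
    obtain ⟨ι, _, _, _, T, hT⟩ := ih
    refine ⟨ν × ι, inferInstance, inferInstance, inferInstance, T.retry hP hR, fun s t => ?_⟩
    set E := ∑ a, P s a with hE
    set F := ∑ b, R t b with hF
    have hEp := isStarProjection_sum (hP.proj s) (hP.orth s) Finset.univ
    have hFp := isStarProjection_sum (hR.proj t) (hR.orth t) Finset.univ
    set p : ℝ := (Fintype.card ν : ℝ)⁻¹ * ((1 - E) * (1 - F)).trace.re with hp
    have hp0 : 0 ≤ p := mul_nonneg (by positivity)
      (Complex.le_def.1 (hEp.one_sub.trace_mul_nonneg hFp.one_sub)).1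
    -- Restricting the trace of `E * F` to winning pairs drops only nonnegative terms. By
    -- inclusion-exclusion this bounds from below the chance that both provers fail.
    have hEF : Fintype.card A * X s t ≤ (E * F).trace.re := by
      rw [← hX, hE, hF, Finset.sum_mul, trace_sum, Complex.re_sum]
      refine Finset.sum_le_sum fun a _ => ?_
      rw [Finset.mul_sum, trace_sum, Complex.re_sum]
      refine Finset.sum_le_sum fun b _ => ?_
      have := (Complex.le_def.1 ((hP.proj s a).trace_mul_nonneg (hR.proj t b))).1
      split_ifs
      · rw [one_mul]
      · rw [zero_mul]; exact this
    have htE : E.trace = Fintype.card A := by rw [hE, trace_sum]; simp [hP1]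
    have htF : F.trace = Fintype.card A := by rw [hF, trace_sum]; simp [hR1]
    have hpr : 1 - 2 * r + r * X s t ≤ p := by
      have h1 : ((1 - E) * (1 - F)).trace.re
          = Fintype.card ν - 2 * Fintype.card A + (E * F).trace.re := by
        have h2 : (1 - E) * (1 - F) = 1 - E - F + E * F := by noncomm_ring
        rw [h2, trace_add, trace_sub, trace_sub, htE, htF, trace_one]
        simp only [Complex.add_re, Complex.sub_re, Complex.natCast_re]
        ring
      have h3 : 1 - 2 * r + r * X s t = (Fintype.card ν : ℝ)⁻¹ *
          (Fintype.card ν - 2 * Fintype.card A + Fintype.card A * X s t) := by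
        rw [hr]; field_simp
      rw [hp, h1, h3]
      exact mul_le_mul_of_nonneg_left (by linarith) (by positivity)
    rw [pow_succ']
    refine (retry_recursion (hX0 s t) (hX1 s t) hr0 (pow_nonneg (by linarith) N)
      (pow_le_one₀ (by linarith) (by linarith)) (hT s t) hp0 hpr).trans ?_
    have h4 : r * X s t = (Fintype.card ν : ℝ)⁻¹ * (Fintype.card A * X s t) := by
      rw [hr]; field_simp
    rw [h4, ← hX]
    simp only [Finset.mul_sum, ← Finset.sum_add_distrib]
    refine Finset.sum_le_sum fun a _ => Finset.sum_le_sum fun b _ => ?_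
    have := T.le_joint_retry hP hR s t a b
    split_ifs
    · simpa only [one_mul] using this
    · simp

open scoped MatrixOrder Matrix.Norms.L2Operator in
theorem Matrix.PosSemidef.exists_eq_conjTranspose_mul_self {n : Type*} [Fintype n] [DecidableEq n]
    {G : Matrix n n ℂ} (hG : G.PosSemidef) : ∃ B : Matrix n n ℂ, G = Bᴴ * B :=
  CStarAlgebra.nonneg_iff_eq_star_mul_self.mp hG.nonneg

theorem left_nonneg_of_posSemidef_dualBlock {Q : Type*} [DecidableEq Q] {M : Q → Q → ℂ}
    {α β : Q → ℝ} (h : (dualBlock M α β).PosSemidef) (s : Q) : 0 ≤ α s := by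
  simpa [dualBlock] using h.diag_nonneg (i := Sum.inl s)

namespace Game

variable {Q A : Type*} [Fintype Q] [Fintype A]

theorem sum_le_entangledValue_of_vectors [Nonempty A] {ν : Type*} [Fintype ν] (G : Game Q A)
    {x y : Q → A → ν → ℂ}
    (hx1 : ∀ s a, star (x s a) ⬝ᵥ x s a = 1) (hx0 : ∀ s a b, a ≠ b → star (x s a) ⬝ᵥ x s b = 0)
    (hy1 : ∀ s a, star (y s a) ⬝ᵥ y s a = 1) (hy0 : ∀ s a b, a ≠ b → star (y s a) ⬝ᵥ y s b = 0)
    (hcard : Fintype.card A ≤ Fintype.card ν) (X : Q → Q → ℝ)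
    (hX0 : ∀ s t, 0 ≤ X s t) (hX1 : ∀ s t, X s t ≤ 1)
    (hX : ∀ s t, ∑ a, ∑ b, (if G.V a b s t = true then 1 else 0) * ‖star (x s a) ⬝ᵥ y t b‖ ^ 2
      = Fintype.card A * X s t) :
    ∑ s, ∑ t, G.prob s t * (2 * X s t - 1) ≤ G.entangledValue := by
  classical
  have hA : (0 : ℝ) < Fintype.card A := by exact_mod_cast Fintype.card_pos
  have hn : (0 : ℝ) < Fintype.card ν := hA.trans_le (by exact_mod_cast hcard)
  have hne : Nonempty ν := Fintype.card_pos_iff.1 (by exact_mod_cast hn)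
  set ρ : ℝ := 1 - Fintype.card A / Fintype.card ν with hρ
  have hρ0 : 0 ≤ ρ := sub_nonneg.2 ((div_le_one hn).2 (by exact_mod_cast hcard))
  have hρ1 : ρ < 1 := sub_lt_self _ (by positivity)
  have hP := isPartialMeasurement_vecMulVec hx1 hx0
  have hR := isPartialMeasurement_vecMulVec hy1 hy0
  have htr : ∀ v : ν → ℂ, star v ⬝ᵥ v = 1 → (vecMulVec v (star v)).trace = 1 := fun v hv => by
    rw [trace_vecMulVec, dotProduct_comm, hv]
  have hN : ∀ N : ℕ, (∑ s, ∑ t, G.prob s t * (X s t / (2 - X s t))) * (1 - ρ ^ N)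
      ≤ G.entangledValue := by
    intro N
    obtain ⟨ι, _, _, _, T, hT⟩ := exists_tracialStrategy hP hR (fun s a => htr _ (hx1 s a))
      (fun t b => htr _ (hy1 t b)) hcard G.V X hX0 hX1
      (by simpa only [re_trace_vecMulVec_mul] using hX) N
    refine le_trans ?_ (T.sum_joint_le_entangledValue G)
    simp only [Finset.sum_mul]
    refine Finset.sum_le_sum fun s _ => Finset.sum_le_sum fun t _ => ?_
    simp only [mul_assoc, ← Finset.mul_sum]
    exact mul_le_mul_of_nonneg_left (hT s t) (G.prob_nonneg s t)
  have hlim : Filter.Tendsto (fun N : ℕ =>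
      (∑ s, ∑ t, G.prob s t * (X s t / (2 - X s t))) * (1 - ρ ^ N)) Filter.atTop
      (nhds ((∑ s, ∑ t, G.prob s t * (X s t / (2 - X s t))) * (1 - 0))) :=
    ((tendsto_pow_atTop_nhds_zero_of_lt_one hρ0 hρ1).const_sub 1).const_mul _
  -- Letting the number of attempts grow leaves `X / (2 - X)`, and `2 * X - 1` is its tangent at `X
  -- = 1`.
  refine le_trans ?_ (le_of_tendsto' hlim hN)
  rw [sub_zero, mul_one]
  refine Finset.sum_le_sum fun s _ => Finset.sum_le_sum fun t _ =>
    mul_le_mul_of_nonneg_left ?_ (G.prob_nonneg s t)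
  rw [le_div_iff₀ (by linarith [hX1 s t])]
  nlinarith [sq_nonneg (X s t - 1)]

variable {H : Type*} [AddCommGroup H] [Fintype H]

/-- The Gram vectors of all `χ`, twisted by `χ (e a)`, are placed in a direct sum over `χ`. Unit
diagonals make the vectors of one question orthonormal in `a`, and inner products between questions
depend only on `e a - e b`, so all winning pairs share the value `z s t`. -/
theorem sum_gramValue_le (G : Game Q A) (e : A ≃ H) (W : Q → Q → H)
    (hW : ∀ s t a b, G.V a b s t = true ↔ e a - e b = W s t)
    (g : AddChar H ℂ → Matrix (Q ⊕ Q) (Q ⊕ Q) ℂ) (hg : ∀ χ, (g χ).PosSemidef)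
    (hg1 : ∀ χ i, g χ i i = 1) :
    4 * ((Fintype.card H : ℝ)⁻¹ * ∑ χ, gramValue (G.fourierCoeff W χ) (g χ)) - 3
      ≤ G.entangledValue := by
  classical
  have : Nonempty A := ⟨e.symm 0⟩
  have hQ : Nonempty Q := by
    by_contra h
    rw [not_nonempty_iff] at h
    have := G.prob_sum
    simp at this
  have hH : (0 : ℝ) < Fintype.card H := by exact_mod_cast Fintype.card_pos
  have hHA : Fintype.card A = Fintype.card H := Fintype.card_congr e
  choose B hB using fun χ => (hg χ).exists_eq_conjTranspose_mul_self
  let z : Q → Q → ℂ := fun s t => (Fintype.card H : ℂ)⁻¹ *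
    ∑ χ : AddChar H ℂ, χ (- W s t) * g χ (Sum.inl s) (Sum.inr t)
  set r : ℝ := (Real.sqrt (Fintype.card H))⁻¹ with hr
  have hr2 : (r : ℂ) * r = (Fintype.card H : ℂ)⁻¹ := by
    rw [hr, ← Complex.ofReal_mul, ← mul_inv, Real.mul_self_sqrt hH.le]
    simp
  let v : Q ⊕ Q → A → AddChar H ℂ × (Q ⊕ Q) → ℂ := fun i a k => r * (k.1 (e a) * B k.1 k.2 i)
  have hv : ∀ i j a b, star (v i a) ⬝ᵥ v j b
      = (Fintype.card H : ℂ)⁻¹ * ∑ χ : AddChar H ℂ, χ (e b - e a) * g χ i j := by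
    intro i j a b
    simp only [dotProduct, Fintype.sum_prod_type, Finset.mul_sum]
    refine Finset.sum_congr rfl fun χ _ => ?_
    rw [show g χ i j = ∑ k, star (B χ k i) * B χ k j by
      rw [hB χ, Matrix.mul_apply]; rfl, ← hr2, sub_eq_add_neg, AddChar.map_add_eq_mul,
      AddChar.map_neg_eq_conj, Finset.mul_sum, Finset.mul_sum]
    refine Finset.sum_congr rfl fun k _ => ?_
    simp only [v, Pi.star_apply, star_mul', Complex.star_def, Complex.conj_ofReal]
    ring
  have hvv : ∀ i a b, star (v i a) ⬝ᵥ v i b = if a = b then 1 else 0 := by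
    intro i a b
    have hc : (Fintype.card H : ℂ) ≠ 0 := Nat.cast_ne_zero.2 Fintype.card_ne_zero
    rw [hv]
    simp only [hg1, mul_one, AddChar.sum_apply_eq_ite, sub_eq_zero, e.injective.eq_iff,
      eq_comm (a := b)]
    split_ifs <;> simp [hc]
  have hvz : ∀ s t a b, e a - e b = W s t → star (v (Sum.inl s) a) ⬝ᵥ v (Sum.inr t) b = z s t := by
    intro s t a b h
    rw [hv, ← neg_sub, h]
  have hz1 : ∀ s t, ‖z s t‖ ≤ 1 := by
    intro s t
    have h1 : ‖∑ χ : AddChar H ℂ, χ (- W s t) * g χ (Sum.inl s) (Sum.inr t)‖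
        ≤ Fintype.card H := by
      refine (norm_sum_le _ _).trans ?_
      rw [← AddChar.card_eq (α := H), ← Finset.card_univ, ← nsmul_one]
      refine Finset.sum_le_card_nsmul _ _ _ fun χ _ => ?_
      rw [norm_mul, AddChar.norm_apply, one_mul]
      exact (hg χ).norm_apply_le_one (fun i => by rw [hg1]; simp) _ _
    simp only [z, norm_mul, norm_inv, Complex.norm_natCast]
    rwa [inv_mul_le_iff₀ hH, mul_one]
  have key := G.sum_le_entangledValue_of_vectors (x := fun s => v (Sum.inl s))
    (y := fun t => v (Sum.inr t)) (fun s a => by rw [hvv, if_pos rfl])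
    (fun s a b hab => by rw [hvv, if_neg hab]) (fun s a => by rw [hvv, if_pos rfl])
    (fun s a b hab => by rw [hvv, if_neg hab])
    -- The space has dimension `|H| * |Q ⊕ Q|`, and `Q` is nonempty because the probabilities sum to
    -- one.
    (by
      rw [hHA, Fintype.card_prod, AddChar.card_eq]
      exact Nat.le_mul_of_pos_right _ Fintype.card_pos)
    (fun s t => ‖z s t‖ ^ 2) (fun s t => sq_nonneg _)
    (fun s t => pow_le_one₀ (norm_nonneg _) (hz1 s t)) (fun s t => by
      have h1 : ∀ a, ∑ b, (if G.V a b s t = true then 1 else 0) *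
          ‖star (v (Sum.inl s) a) ⬝ᵥ v (Sum.inr t) b‖ ^ 2 = ‖z s t‖ ^ 2 := by
        -- Linearity leaves exactly one winning `b` for each `a`.
        intro a
        have hb : e a - e (e.symm (e a - W s t)) = W s t := by simp
        rw [Finset.sum_eq_single (e.symm (e a - W s t))]
        · rw [if_pos ((hW _ _ _ _).2 hb), one_mul, hvz s t a _ hb]
        · intro b _ hne
          rw [if_neg, zero_mul]
          rw [hW]
          intro h
          apply hne
          rw [← h]; simp
        · exact fun h => absurd (Finset.mem_univ _) h
      simp only [h1, Finset.sum_const, Finset.card_univ, nsmul_eq_mul])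
  refine le_trans ?_ key
  have hsum : (Fintype.card H : ℝ)⁻¹ * ∑ χ, gramValue (G.fourierCoeff W χ) (g χ)
      = ∑ s, ∑ t, G.prob s t * (z s t).re := by
    simp only [gramValue, ← Complex.re_sum, ← Complex.re_ofReal_mul]
    congr 1
    rw [Finset.sum_comm, Finset.mul_sum]
    refine Finset.sum_congr rfl fun s _ => ?_
    rw [Finset.sum_comm, Finset.mul_sum]
    refine Finset.sum_congr rfl fun t _ => ?_
    simp only [z, fourierCoeff, Finset.mul_sum]
    refine Finset.sum_congr rfl fun χ _ => ?_
    push_cast; ring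
  have h3 : (3 : ℝ) = ∑ s, ∑ t, G.prob s t * 3 := by
    simp only [← Finset.sum_mul, G.prob_sum, one_mul]
  rw [hsum, h3]
  simp only [Finset.mul_sum, ← Finset.sum_sub_distrib]
  -- Termwise this is `4 * Re z - 3 ≤ 2 * ‖z‖ ^ 2 - 1`, from `2 * (‖z‖ - 1) ^ 2 ≥ 0`.
  refine Finset.sum_le_sum fun s _ => Finset.sum_le_sum fun t _ => ?_
  have h4 : (z s t).re ≤ ‖z s t‖ := Complex.re_le_norm _
  nlinarith [mul_le_mul_of_nonneg_left h4 (G.prob_nonneg s t),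
    mul_nonneg (G.prob_nonneg s t) (sq_nonneg (‖z s t‖ - 1))]

theorem entangledValue_pow_le [Nonempty A] (G : Game Q A) (m : ℕ) :
    G.entangledValue ^ m ≤ (G.power m).entangledValue := by
  classical
  obtain ⟨a₀⟩ := ‹Nonempty A›
  have hproj : ∀ a, IsStarProjection
      (if a = a₀ then (1 : Matrix (Fin 1) (Fin 1) ℂ) else 0) := by
    intro a
    split_ifs
    · exact IsStarProjection.one _
    · exact IsStarProjection.zero _
  have hne : {p : ℝ | ∃ (d : ℕ) (S : EntangledStrategy Q A d), p = G.winProb S}.Nonempty :=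
    ⟨_, 1, ⟨fun _ => 1, by simp [dotProduct], fun _ a => if a = a₀ then 1 else 0, fun _ => hproj,
      fun _ => by simp, fun _ a => if a = a₀ then 1 else 0, fun _ => hproj, fun _ => by simp⟩, rfl⟩
  obtain ⟨u, -, hu, hmem⟩ := exists_seq_tendsto_sSup hne
    ⟨1, by rintro _ ⟨d, S, rfl⟩; exact G.winProb_le_one S⟩
  refine le_of_tendsto' (hu.pow m) fun n => ?_
  obtain ⟨d, S, hS⟩ := hmem n
  rw [hS]
  exact G.winProb_pow_le_entangledValue_power S m

end Game

end Iteration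

theorem mainTheorem9 {Q A : Type*} [Fintype Q] [Fintype A] (G : Game Q A) (hG : G.IsLinear)
    (ε : ℝ) (hε : G.entangledValue = 1 - ε) (m : ℕ) :
    (1 - ε) ^ m ≤ (G.power m).entangledValue ∧
      (G.power m).entangledValue ≤ (1 - ε / 4) ^ m := by
  classical
  obtain ⟨H, _, e, W, hW⟩ := hG
  have : Fintype H := Fintype.ofEquiv A e
  have : Nonempty A := ⟨e.symm 0⟩
  refine ⟨hε ▸ G.entangledValue_pow_le m, ?_⟩
  choose g α β hg hg1 hα hβ hdual using fun χ : AddChar H ℂ => exists_gram_dual (G.fourierCoeff W χ)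
  set Γ : ℝ := (Fintype.card H : ℝ)⁻¹ * ∑ χ, gramValue (G.fourierCoeff W χ) (g χ) with hΓ
  have hle : Γ ≤ 1 - ε / 4 := by
    have := G.sum_gramValue_le e W hW g hg hg1
    rw [hε] at this
    linarith
  -- Needed for monotonicity of the `m`-th power; it holds since diagonal entries of the dual
  -- solutions are nonnegative.
  have hΓ0 : 0 ≤ Γ := mul_nonneg (by positivity)
    (Finset.sum_nonneg fun χ _ => hα χ ▸
      Finset.sum_nonneg fun s _ => left_nonneg_of_posSemidef_dualBlock (hdual χ) s)
  refine Real.sSup_le ?_ (pow_nonneg (hΓ0.trans hle) m)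
  rintro _ ⟨d, S, rfl⟩
  exact (G.winProb_power_le e W hW _ α β hα hβ hdual S).trans (pow_le_pow_left₀ hΓ0 hle m)
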